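/- An inversion sequence of length $n$ is an integer sequence $\sigma=(\sigma_1,\dots,\sigma_n)$ with $\sigma_i\in\{0,\dots,i-1\}$ for all $i$. A Cayley permutation of length $n$ is an integer sequence $\rho=(\rho_1,\dots,\rho_n)$ whose set of values is exactly $\{0,\dots,\max(\rho)\}$ (the empty sequence counts as one); $\mathcal P_n$ denotes the set of these. A sequence $\sigma$ contains a sequence $\tau$, written $\tau\preceq\sigma$, if some subsequence of $\sigma$ is order-isomorphic to $\tau$ (with equal entries corresponding to equal entries). For a nonempty sequence $\rho$ of nonnegative integers of length $k$, let $\mathbf{mdd}(\rho)=\max_{1\le i\le k}(\rho_i-i+1)$. For a nonempty Cayley permutation $\rho$, a $\rho$-minimal inversion sequence is a minimal element, with respect to $\preceq$, of the set of all inversion sequences (of any length) that are Cayley permutations and contain $\rho$. For $n,m\ge 0$, let $\mathcal A_{n,m}$ be the set of pairs consisting of an inversion sequence $\alpha$ of length $n$ and a colouring of the values $0,\dots,n-1$ (whether or not they occur in $\alpha$) such that each value is blue or red, exactly $m$ values are blue and $n-m$ are red, and each red value occurs at least twice in $\alpha$. (Thus $\mathcal A_{n,m}=\emptyset$ if $n<m$.)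 **Proposition.** Let $k\ge 1$, $m\ge 0$, and let $\rho\in\mathcal P_k$ be such that $\rho_1=\mathbf{mdd}(\rho)=m$. Then for every $n\ge 0$, the number of $\rho$-minimal inversion sequences of length $n+k$ is $|\mathcal A_{n,m}|$. -/

import Mathlib

namespace InvSeq

/-- Inversion sequences of length `n`. With positions numbered from `0`, the condition
`σ_i ∈ {0, …, i - 1}` (positions numbered from `1`) reads `σ i ≤ i`. -/
def IsInversionSeq {n : ℕ} (σ : Fin n → ℕ) : Prop :=
  ∀ i : Fin n, σ i ≤ (i : ℕ)

/-- Cayley permutations of length `n`, with values starting at `0`: the set of values is exactly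
`{0, …, max ρ}` (which is empty for the empty sequence). -/
def IsCayleyPerm {n : ℕ} (ρ : Fin n → ℕ) : Prop :=
  Set.range ρ = {v : ℕ | ∃ i : Fin n, v ≤ ρ i}

/-- `Contains τ σ` (written `τ ≼ σ`): some subsequence of `σ` has its entries in the same relative
order as the entries of `τ`. Entries of equal value in `τ` correspond to entries of equal value in
`σ`, since the equivalence below is required for `(i, j)` and for `(j, i)`. -/
def Contains {l n : ℕ} (τ : Fin l → ℕ) (σ : Fin n → ℕ) : Prop :=
  ∃ f : Fin l ↪o Fin n, ∀ i j : Fin l, τ i < τ j ↔ σ (f i) < σ (f j)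

/-- The maximum diagonal difference `max_i (σ_i - i + 1)` (positions `i` numbered from `1`) of a
nonempty sequence. -/
def mdd {k : ℕ} [NeZero k] (σ : Fin k → ℕ) : ℤ :=
  Finset.univ.sup' Finset.univ_nonempty (fun i : Fin k => (σ i : ℤ) - ((i : ℕ) : ℤ))

/-- Membership in the set of inversion sequences, of any length, that are Cayley permutations and
contain the pattern `ρ`. -/
def MemIP {k l : ℕ} (ρ : Fin k → ℕ) (σ : Fin l → ℕ) : Prop :=
  IsInversionSeq σ ∧ IsCayleyPerm σ ∧ Contains ρ σ

/-- `σ` is a `ρ`-minimal inversion sequence: a minimal element, for pattern containment, of the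
set of all inversion sequences (of all lengths) that are Cayley permutations and contain `ρ`. -/
def IsMinimalFor {k l : ℕ} (ρ : Fin k → ℕ) (σ : Fin l → ℕ) : Prop :=
  MemIP ρ σ ∧ ∀ (p : ℕ) (τ : Fin p → ℕ), MemIP ρ τ → Contains τ σ → Contains σ τ

/-- The two colours. -/
inductive Colour : Type
  | blue : Colour
  | red : Colour

/-- The set `𝒜_{n,m}` of coloured inversion sequences `(α, c)` of length `n`: here `c` assigns a
colour to each value in `{0, …, n - 1}`, whether or not the value occurs in `α`; there are `m` blue
values and `n - m` red values, and each red value occurs at least twice in `α`.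
(If `n < m`, there cannot be `m` blue values, so the set is empty.) -/
def colouredSeqs (n m : ℕ) : Set ((Fin n → ℕ) × (Fin n → Colour)) :=
  {x | IsInversionSeq x.1 ∧
    {v : Fin n | x.2 v = Colour.blue}.ncard = m ∧
    {v : Fin n | x.2 v = Colour.red}.ncard = n - m ∧
    ∀ v : Fin n, x.2 v = Colour.red → 2 ≤ {i : Fin n | x.1 i = (v : ℕ)}.ncard}

end InvSeq

/-!
A minimal sequence cannot lose a single entry outside an occurrence of `ρ`. Deleting an entry at
`x` and closing the gap in the values leaves an inversion sequence if the value at `x` is not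
repeated, or if no later entry lies on the diagonal `σ y = y`. So every entry outside the occurrence
has a twin and precedes the last diagonal entry, which belongs to the occurrence. Let `v` be the
value at which the occurrence starts. Because `ρ j ≤ ρ 0 + j`, the occurrence skips, between `v` and
the last diagonal entry, at least as many values as positions; each skipped value is taken at a
skipped position, so these positions would carry distinct, unrepeated values. Hence no position from
`v` on is skipped: the occurrence is a suffix starting on the diagonal, and all earlier entries have
twins.

Conversely, such reduced sequences form an antichain, because they all have the same number of
repeats (entries in excess of one per value), both in total and in the suffix. Finally, a reduced
sequence is determined by its prefix and by the set of values below `n` used by the suffix, which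
are coloured blue; the other values below `n` must occur twice in the prefix.
-/

namespace InvSeq

open Finset

section OrderIsomorphic

variable {ι α β : Type*}

/-- Order isomorphism of sequences indexed by the same type: `Contains τ σ` says that `τ` is
order-isomorphic to some subsequence `σ ∘ f`. -/
def OrderIsomorphic [LT α] [LT β] (a : ι → α) (b : ι → β) : Prop :=
  ∀ i j, a i < a j ↔ b i < b j

lemma OrderIsomorphic.trans {γ : Type*} [LT α] [LT β] [LT γ] {a : ι → α} {b : ι → β} {c : ι → γ}
    (h : OrderIsomorphic a b) (h' : OrderIsomorphic b c) : OrderIsomorphic a c :=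
  fun i j => (h i j).trans (h' i j)

lemma OrderIsomorphic.comp {κ : Type*} [LT α] [LT β] {a : ι → α} {b : ι → β}
    (h : OrderIsomorphic a b) (f : κ → ι) : OrderIsomorphic (a ∘ f) (b ∘ f) :=
  fun i j => h (f i) (f j)

variable [LinearOrder α] [LinearOrder β] {a : ι → α} {b : ι → β}

lemma OrderIsomorphic.eq_iff (h : OrderIsomorphic a b) (i j : ι) : a i = a j ↔ b i = b j := by
  simp only [le_antisymm_iff, ← not_lt, h i j, h j i]

lemma OrderIsomorphic.card_image (h : OrderIsomorphic a b) (T : Finset ι) :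
    #(T.image a) = #(T.image b) := by
  set graph := T.image fun i => (a i, b i) with hgraph
  have hfst : Set.InjOn Prod.fst (graph : Set (α × β)) := by
    simp only [hgraph, coe_image]
    rintro _ ⟨i, -, rfl⟩ _ ⟨j, -, rfl⟩ hij
    exact Prod.ext hij ((h.eq_iff i j).1 hij)
  have hsnd : Set.InjOn Prod.snd (graph : Set (α × β)) := by
    simp only [hgraph, coe_image]
    rintro _ ⟨i, -, rfl⟩ _ ⟨j, -, rfl⟩ hij
    exact Prod.ext ((h.eq_iff i j).2 hij) hij
  calc #(T.image a) = #(graph.image Prod.fst) := by rw [hgraph, image_image]; rfl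
    _ = #(graph.image Prod.snd) := by rw [card_image_of_injOn hfst, card_image_of_injOn hsnd]
    _ = #(T.image b) := by rw [hgraph, image_image]; rfl

end OrderIsomorphic

section Repeats

variable {ι α : Type*} [DecidableEq α] {s : ι → α} {S T : Finset ι}

/-- The number of entries of `s` on `T` in excess of one per value. Since there are at most `#T`
values, the subtraction does not truncate. -/
def repeats (s : ι → α) (T : Finset ι) : ℕ :=
  #T - #(T.image s)

lemma repeats_add_card_image (s : ι → α) (T : Finset ι) : repeats s T + #(T.image s) = #T :=
  Nat.sub_add_cancel card_image_le

lemma repeats_le_repeats (h : S ⊆ T) : repeats s S ≤ repeats s T := by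
  classical
  have hcard : #(T.image s) ≤ #(S.image s) + #(T \ S) := by
    calc #(T.image s) = #(S.image s ∪ (T \ S).image s) := by
          rw [← image_union, union_sdiff_of_subset h]
      _ ≤ #(S.image s) + #(T \ S) := (card_union_le _ _).trans (by gcongr; exact card_image_le)
  have hS := repeats_add_card_image s S
  have hT := repeats_add_card_image s T
  have hsdiff := card_sdiff_add_card_eq_card h
  omega

lemma repeats_eq_iff (h : S ⊆ T) :
    repeats s S = repeats s T ↔ ∀ x ∈ T, x ∉ S → ∀ y ∈ T, s y = s x → y = x := by
  classical
  have hT := repeats_add_card_image s T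
  refine ⟨fun heq x hx hxS y hy hyx => ?_, fun huniq => ?_⟩
  · by_contra hne
    have hST : S ⊆ T.erase x := subset_erase.2 ⟨h, hxS⟩
    have himage : (T.erase x).image s = T.image s := by
      refine (image_subset_image (erase_subset x T)).antisymm fun v hv => ?_
      obtain ⟨z, hz, rfl⟩ := mem_image.1 hv
      by_cases hzx : z = x
      · exact mem_image.2 ⟨y, mem_erase.2 ⟨hne, hy⟩, by rw [hyx, hzx]⟩
      · exact mem_image_of_mem s (mem_erase.2 ⟨hzx, hz⟩)
    have hle := repeats_le_repeats (s := s) hST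
    have herase := repeats_add_card_image s (T.erase x)
    have hcard := card_erase_add_one hx
    rw [himage] at herase
    omega
  · have hinj : Set.InjOn s (T \ S : Finset ι) := fun x hx y hy hxy =>
      huniq y (mem_sdiff.1 hy).1 (mem_sdiff.1 hy).2 x (mem_sdiff.1 hx).1 hxy
    have hdisj : Disjoint (S.image s) ((T \ S).image s) := by
      simp only [disjoint_left, mem_image, mem_sdiff]
      rintro _ ⟨y, hy, rfl⟩ ⟨x, ⟨hxT, hxS⟩, hxy⟩
      exact hxS (huniq x hxT hxS y (h hy) hxy.symm ▸ hy)
    have himage : #(T.image s) = #(S.image s) + #(T \ S) := by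
      rw [← card_image_of_injOn hinj, ← card_union_of_disjoint hdisj, ← image_union,
        union_sdiff_of_subset h]
    have hS := repeats_add_card_image s S
    have hsdiff := card_sdiff_add_card_eq_card h
    omega

lemma OrderIsomorphic.repeats_eq {ι κ α β : Type*} [LinearOrder α] [LinearOrder β] {t : κ → α}
    {s : ι → β} {f : κ ↪ ι} (h : OrderIsomorphic t (s ∘ f)) (T : Finset κ) :
    repeats t T = repeats s (T.map f) := by
  classical
  rw [repeats, repeats, card_map, map_eq_image, image_image, h.card_image]

end Repeats

section Standardize

variable {ι α β : Type*} [Fintype ι] [LinearOrder α] [LinearOrder β]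

/-- The standardization of a sequence: each entry is replaced by the number of distinct smaller
entries. It is the Cayley permutation order-isomorphic to the sequence. -/
def standardize (s : ι → α) (i : ι) : ℕ :=
  #{v ∈ univ.image s | v < s i}

lemma standardize_orderIsomorphic (s : ι → α) : OrderIsomorphic (standardize s) s := by
  refine fun i j => ⟨fun h => ?_, fun h => card_lt_card ?_⟩
  · contrapose! h
    exact card_le_card (monotone_filter_right _ fun v _ hv => hv.trans_le h)
  · refine (ssubset_iff_of_subset (monotone_filter_right _ fun v _ hv => hv.trans h)).2 ?_
    exact ⟨s i, by simpa using h, by simp⟩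

lemma OrderIsomorphic.standardize_eq {a : ι → α} {b : ι → β} (h : OrderIsomorphic a b) :
    standardize a = standardize b := by
  ext i
  simp only [standardize, filter_image, h _ i, h.card_image]

lemma standardize_le (s : ι → ℕ) (i : ι) : standardize s i ≤ s i := by
  calc standardize s i ≤ #(range (s i)) := card_le_card fun v hv => by
        simpa using (mem_filter.1 hv).2
    _ = s i := card_range _

lemma standardize_lt_of_forall_ne {s : ι → ℕ} {v : ℕ} (hv : ∀ j, s j ≠ v) {i : ι}
    (hi : v < s i) : standardize s i < s i := by
  calc standardize s i ≤ #((range (s i)).erase v) := card_le_card fun w hw => by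
        obtain ⟨hw, hwi⟩ := mem_filter.1 hw
        obtain ⟨j, -, rfl⟩ := mem_image.1 hw
        exact mem_erase.2 ⟨hv j, mem_range.2 hwi⟩
    _ < #(range (s i)) := card_erase_lt_of_mem (mem_range.2 hi)
    _ = s i := card_range _

lemma card_filter_lt_orderEmb {n : ℕ} (f : Fin n ↪o α) (i : Fin n) :
    #{y ∈ univ.map f.toEmbedding | y < f i} = i := by
  simp [filter_map, filter_gt_eq_Iio]

end Standardize

section CayleyPerm

variable {n : ℕ} {ρ : Fin n → ℕ}

lemma isCayleyPerm_iff : IsCayleyPerm ρ ↔ ∀ i, ∀ v ≤ ρ i, ∃ j, ρ j = v := by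
  refine ⟨fun h i v hv => h.ge ⟨i, hv⟩, fun h => Set.ext fun v => ?_⟩
  exact ⟨fun ⟨j, hj⟩ => ⟨j, hj.ge⟩, fun ⟨i, hi⟩ => h i v hi⟩

lemma isCayleyPerm_standardize {α : Type*} [LinearOrder α] (s : Fin n → α) :
    IsCayleyPerm (standardize s) := by
  refine isCayleyPerm_iff.2 fun i v hv => ?_
  set S := univ.image s
  have hcard : v < #S :=
    hv.trans_lt (card_lt_card (filter_ssubset.2 ⟨s i, by simp, lt_irrefl _⟩))
  obtain ⟨j, -, hj⟩ := mem_image.1 (S.orderEmbOfFin_mem rfl ⟨v, hcard⟩)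
  refine ⟨j, ?_⟩
  have hrank := card_filter_lt_orderEmb (S.orderEmbOfFin rfl) ⟨v, hcard⟩
  rwa [map_orderEmbOfFin_univ, ← hj] at hrank

lemma IsCayleyPerm.standardize_eq (h : IsCayleyPerm ρ) : standardize ρ = ρ := by
  ext i
  have hvalues : {v ∈ univ.image ρ | v < ρ i} = range (ρ i) := by
    ext v
    simp only [mem_filter, mem_image, mem_univ, true_and, mem_range, and_iff_right_iff_imp]
    exact fun hv => isCayleyPerm_iff.1 h i v hv.le
  rw [standardize, hvalues, card_range]

lemma IsCayleyPerm.card_values_lt (h : IsCayleyPerm ρ) {α : Type*} [LinearOrder α]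
    {s : Fin n → α} (hs : OrderIsomorphic ρ s) (i : Fin n) :
    #{v ∈ univ.image s | v < s i} = ρ i := by
  change standardize s i = ρ i
  rw [← hs.standardize_eq, h.standardize_eq]

lemma IsCayleyPerm.le_of_orderIsomorphic (h : IsCayleyPerm ρ) {s : Fin n → ℕ}
    (hs : OrderIsomorphic ρ s) (i : Fin n) : ρ i ≤ s i := by
  rw [← h.card_values_lt hs i]
  exact standardize_le s i

end CayleyPerm

section Containment

variable {k l n : ℕ} {ρ : Fin k → ℕ} {τ : Fin l → ℕ} {σ : Fin n → ℕ}

lemma Contains.trans (h : Contains ρ τ) (h' : Contains τ σ) : Contains ρ σ := by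
  obtain ⟨f, hf⟩ := h
  obtain ⟨g, hg⟩ := h'
  exact ⟨f.trans g, OrderIsomorphic.trans hf (OrderIsomorphic.comp hg f)⟩

lemma Contains.length_le (h : Contains τ σ) : l ≤ n := by
  obtain ⟨f, -⟩ := h
  simpa using Fintype.card_le_of_embedding f.toEmbedding

lemma Contains.symm_of_length_le (h : Contains τ σ) (hnl : n ≤ l) : Contains σ τ := by
  obtain rfl := hnl.antisymm h.length_le
  obtain ⟨f, hf⟩ := h
  have hid : ⇑f = id := (f.strictMono.range_inj strictMono_id).1 <| by
    rw [(Finite.surjective_of_injective f.injective).range_eq, Set.range_id]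
  exact ⟨RelEmbedding.refl _, fun i j => by simpa [hid] using (hf i j).symm⟩

lemma MemIP.exists_isMinimalFor (h : MemIP ρ σ) :
    ∃ (p : ℕ) (υ : Fin p → ℕ), IsMinimalFor ρ υ ∧ Contains υ σ := by
  induction n using Nat.strong_induction_on with
  | _ n ih =>
    by_cases hmin : IsMinimalFor ρ σ
    · exact ⟨n, σ, hmin, RelEmbedding.refl _, fun _ _ => Iff.rfl⟩
    · simp only [IsMinimalFor, h, true_and, not_forall] at hmin
      obtain ⟨p, τ, hτ, hτσ, hστ⟩ := hmin
      have hlt : p < n := hτσ.length_le.lt_of_not_ge fun hle => hστ (hτσ.symm_of_length_le hle)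
      obtain ⟨q, υ, hυ, hυτ⟩ := ih p hlt hτ
      exact ⟨q, υ, hυ, hυτ.trans hτσ⟩

end Containment

section Delete

variable {k N : ℕ} {ρ : Fin k → ℕ} {σ : Fin (N + 1) → ℕ} {x : Fin (N + 1)}

/-- The standardization of the sequence obtained from `σ` by deleting the entry at position `x`. -/
def delete (σ : Fin (N + 1) → ℕ) (x : Fin (N + 1)) : Fin N → ℕ :=
  standardize (σ ∘ x.succAbove)

lemma delete_contains (σ : Fin (N + 1) → ℕ) (x : Fin (N + 1)) : Contains (delete σ x) σ :=
  ⟨x.succAboveOrderEmb, standardize_orderIsomorphic _⟩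

lemma contains_delete {f : Fin k ↪o Fin (N + 1)} (hf : OrderIsomorphic ρ (σ ∘ f))
    (hx : x ∉ Set.range f) : Contains ρ (delete σ x) := by
  choose g hg using fun i => Fin.exists_succAbove_eq fun h : f i = x => hx ⟨i, h⟩
  refine ⟨OrderEmbedding.ofStrictMono g fun i j hij => ?_, fun i j => ?_⟩
  · rw [← (Fin.strictMono_succAbove x).lt_iff_lt, hg, hg]
    exact f.strictMono hij
  · refine (hf i j).trans ?_
    simp only [Function.comp_apply, ← hg]
    exact (standardize_orderIsomorphic (σ ∘ x.succAbove) (g i) (g j)).symm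

lemma isInversionSeq_delete_of_unique (hσ : IsInversionSeq σ) (hx : ∀ y, y ≠ x → σ y ≠ σ x) :
    IsInversionSeq (delete σ x) := by
  intro i
  have hle : delete σ x i ≤ σ (x.succAbove i) := standardize_le _ i
  have hi := hσ (x.succAbove i)
  rcases lt_or_ge i.castSucc x with hix | hxi
  · rw [Fin.succAbove_of_castSucc_lt x i hix] at hle hi
    exact hle.trans hi
  · have hxσ := hσ x
    rw [Fin.succAbove_of_le_castSucc x i hxi, Fin.val_succ] at hi
    rw [Fin.succAbove_of_le_castSucc x i hxi] at hle
    have hval : (x : ℕ) ≤ i := hxi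
    -- An entry that moves left is below `σ x ≤ x`, or above `σ x` and drops by one.
    rcases lt_or_gt_of_ne (hx i.succ (Fin.le_castSucc_iff.1 hxi).ne') with hlt | hgt
    · omega
    · have hlt : delete σ x i < σ (x.succAbove i) :=
        standardize_lt_of_forall_ne (v := σ x) (fun j => hx _ (Fin.succAbove_ne x j))
          (by simpa [Fin.succAbove_of_le_castSucc x i hxi] using hgt)
      rw [Fin.succAbove_of_le_castSucc x i hxi] at hlt
      omega

lemma isInversionSeq_delete_of_lt (hσ : IsInversionSeq σ) (hx : ∀ y, x < y → σ y < y) :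
    IsInversionSeq (delete σ x) := by
  intro i
  have hle : delete σ x i ≤ σ (x.succAbove i) := standardize_le _ i
  rcases lt_or_ge i.castSucc x with hix | hxi
  · rw [Fin.succAbove_of_castSucc_lt x i hix] at hle
    exact hle.trans (hσ i.castSucc)
  · rw [Fin.succAbove_of_le_castSucc x i hxi] at hle
    exact hle.trans (Nat.lt_succ_iff.1 (hx i.succ (Fin.le_castSucc_iff.1 hxi)))

end Delete

section Minimal

variable {k N : ℕ} {ρ : Fin k → ℕ} {σ : Fin N → ℕ} {f : Fin k ↪o Fin N} {x : Fin N}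

lemma IsMinimalFor.not_isInversionSeq_delete {σ : Fin (N + 1) → ℕ} (hσ : IsMinimalFor ρ σ)
    {f : Fin k ↪o Fin (N + 1)} (hf : OrderIsomorphic ρ (σ ∘ f)) {x : Fin (N + 1)}
    (hx : x ∉ Set.range f) : ¬ IsInversionSeq (delete σ x) := fun hinv =>
  have hmem : MemIP ρ (delete σ x) := ⟨hinv, isCayleyPerm_standardize _, contains_delete hf hx⟩
  (Nat.lt_succ_self N).not_ge (hσ.2 N _ hmem (delete_contains σ x)).length_le

lemma IsMinimalFor.exists_ne_apply_eq (hσ : IsMinimalFor ρ σ) (hf : OrderIsomorphic ρ (σ ∘ f))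
    (hx : x ∉ Set.range f) : ∃ y, y ≠ x ∧ σ y = σ x := by
  obtain _ | N := N
  · exact x.elim0
  · by_contra! huniq
    exact hσ.not_isInversionSeq_delete hf hx (isInversionSeq_delete_of_unique hσ.1.1 huniq)

lemma IsMinimalFor.exists_gt_apply_eq_self (hσ : IsMinimalFor ρ σ)
    (hf : OrderIsomorphic ρ (σ ∘ f)) (hx : x ∉ Set.range f) : ∃ y, x < y ∧ σ y = y := by
  obtain _ | N := N
  · exact x.elim0
  · by_contra! hne
    exact hσ.not_isInversionSeq_delete hf hx
      (isInversionSeq_delete_of_lt hσ.1.1 fun y hy => (hσ.1.1 y).lt_of_ne (hne y hy))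

lemma le_card_skipped_values (hρ : IsCayleyPerm ρ) {s : Fin k → ℕ}
    (hs : OrderIsomorphic ρ s) {i j : Fin k} (hij : s i ≤ s j) :
    s j + ρ i ≤ #(Ico (s i) (s j) \ univ.image s) + ρ j + s i := by
  have hused : #(Ico (s i) (s j) ∩ univ.image s) + ρ i ≤ ρ j := by
    rw [← hρ.card_values_lt hs i, ← hρ.card_values_lt hs j, ← card_union_of_disjoint]
    · refine card_le_card fun v hv => ?_
      simp only [mem_union, mem_inter, mem_Ico, mem_filter] at hv ⊢
      grind
    · simp only [disjoint_left, mem_inter, mem_Ico, mem_filter]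
      exact fun v hv hv' => hv'.2.not_ge hv.1.1
  have hsplit := card_sdiff_add_card_inter (Ico (s i) (s j)) (univ.image s)
  rw [Nat.card_Ico] at hsplit
  omega

variable [NeZero k]

lemma IsMinimalFor.exists_last_diagonal (hσ : IsMinimalFor ρ σ)
    (hf : OrderIsomorphic ρ (σ ∘ f)) :
    ∃ j, σ (f j) = f j ∧ ∀ x, x ∉ Set.range f → x < f j := by
  have : NeZero N := ⟨by have := (f 0).2; omega⟩
  obtain ⟨q, hq, hmax⟩ := exists_max_image {y : Fin N | σ y = y} id
    ⟨0, by simpa using hσ.1.1 0⟩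
  simp only [mem_filter, mem_univ, true_and, id] at hq hmax
  have hlt : ∀ x, x ∉ Set.range f → x < q := fun x hx => by
    obtain ⟨y, hxy, hy⟩ := hσ.exists_gt_apply_eq_self hf hx
    exact hxy.trans_le (hmax y hy)
  obtain ⟨j, rfl⟩ : q ∈ Set.range f := by
    by_contra hqf
    exact lt_irrefl q (hlt q hqf)
  exact ⟨j, hq, hlt⟩

lemma card_skipped_positions_le {j : Fin k} {a : ℕ} (ha : a ≤ f 0)
    {S : Finset (Fin N)} (hS : ∀ x ∈ S, a ≤ x ∧ x < f j ∧ x ∉ Set.range f) :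
    #S + j + a ≤ f j := by
  have hdisj : Disjoint S ((Iio j).map f.toEmbedding) := disjoint_left.2 fun x hx hxf => by
    obtain ⟨i, -, rfl⟩ := mem_map.1 hxf
    exact (hS _ hx).2.2 ⟨i, rfl⟩
  have hsub : (S ∪ (Iio j).map f.toEmbedding).map Fin.valEmbedding ⊆ Ico a (f j) := by
    intro y hy
    obtain ⟨x, hx, rfl⟩ := mem_map.1 hy
    rcases mem_union.1 hx with hx | hx
    · exact mem_Ico.2 ⟨(hS x hx).1, (hS x hx).2.1⟩
    · obtain ⟨i, hi, rfl⟩ := mem_map.1 hx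
      exact mem_Ico.2 ⟨ha.trans (f.monotone (Fin.zero_le i)), f.strictMono (mem_Iio.1 hi)⟩
  have hcard := card_le_card hsub
  rw [card_map, card_union_of_disjoint hdisj, card_map, Fin.card_Iio, Nat.card_Ico] at hcard
  have hle : f 0 ≤ f j := f.monotone (Fin.zero_le j)
  rw [Fin.le_def] at hle
  omega

lemma IsMinimalFor.mem_range_of_le (hρ : IsCayleyPerm ρ) (hdiag : ∀ j, ρ j ≤ ρ 0 + j)
    (hσ : IsMinimalFor ρ σ) (hf : OrderIsomorphic ρ (σ ∘ f)) (hx : σ (f 0) ≤ x) :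
    x ∈ Set.range f := by
  classical
  obtain ⟨j, hj, hlt⟩ := hσ.exists_last_diagonal hf
  have hfj : (f 0 : ℕ) ≤ f j := f.monotone (Fin.zero_le j)
  have hf0 : σ (f 0) ≤ f 0 := hσ.1.1 _
  set P : Finset (Fin N) := {y | σ (f 0) ≤ y ∧ y ∉ Set.range f}
  set V := Ico (σ (f 0)) (σ (f j)) \ univ.image (σ ∘ f)
  have hmemP : ∀ y, σ y ∈ V → y ∈ P := fun y hy => by
    simp only [V, mem_sdiff, mem_Ico, mem_image, mem_univ, true_and, not_exists] at hy
    refine mem_filter.2 ⟨mem_univ y, hy.1.1.trans (hσ.1.1 y), ?_⟩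
    rintro ⟨i, rfl⟩
    exact hy.2 i rfl
  have hVP : V ⊆ P.image σ := fun v hv => by
    obtain ⟨y, rfl⟩ :=
      isCayleyPerm_iff.1 hσ.1.2.1 (f j) v (mem_Ico.1 (mem_sdiff.1 hv).1).2.le
    exact mem_image_of_mem σ (hmemP y hv)
  have hPV : #P ≤ #V := by
    have hskip : #P + j + σ (f 0) ≤ f j := card_skipped_positions_le hf0 fun y hy =>
      have hy := (mem_filter.1 hy).2
      ⟨hy.1, hlt y hy.2, hy.2⟩
    have hval : σ (f j) + ρ 0 ≤ #V + ρ j + σ (f 0) :=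
      le_card_skipped_values hρ hf (hf0.trans (hfj.trans hj.ge))
    have hdiag := hdiag j
    omega
  -- Hence `σ` is injective on `P` with image `V`: an element of `P` could have no twin.
  have himage : V = P.image σ := eq_of_subset_of_card_le hVP (card_image_le.trans hPV)
  have hinj : Set.InjOn σ P := card_image_iff.1 (card_image_le.antisymm (himage ▸ hPV))
  by_contra hxf
  have hxP : x ∈ P := mem_filter.2 ⟨mem_univ x, hx, hxf⟩
  obtain ⟨y, hyx, hσy⟩ := hσ.exists_ne_apply_eq hf hxf
  have hyP : y ∈ P := hmemP y (hσy ▸ himage ▸ mem_image_of_mem σ hxP)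
  exact hyx (hinj hyP hxP hσy)

end Minimal

lemma castAdd_lt_natAdd {n k : ℕ} (i : Fin n) (j : Fin k) : Fin.castAdd k i < Fin.natAdd n j :=
  i.2.trans_le (Nat.le_add_right n j)

section Reduced

variable {k n n' : ℕ} [NeZero k] {ρ : Fin k → ℕ}

/-- The normal form of the `ρ`-minimal inversion sequences of length `n + k`: the last `k` entries
form the occurrence of `ρ`, which starts on the diagonal, and the value of each of the first `n`
entries is repeated elsewhere. -/
structure IsReduced (ρ : Fin k → ℕ) (σ : Fin (n + k) → ℕ) : Prop where
  inv : IsInversionSeq σ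
  cayley : IsCayleyPerm σ
  occ : OrderIsomorphic ρ (σ ∘ Fin.natAdd n)
  first : σ (Fin.natAdd n 0) = n
  twin : ∀ i : Fin n, ∃ y, y ≠ Fin.castAdd k i ∧ σ y = σ (Fin.castAdd k i)

lemma eq_natAddOrderEmb_of_range_eq_Ici {f : Fin k ↪o Fin (n + k)}
    (hf : Set.range f = Set.Ici (f 0)) : f = Fin.natAddOrderEmb n := by
  have hcard : k = n + k - f 0 := by
    calc k = #(univ.map f.toEmbedding) := by rw [card_map, card_fin]
      _ = #(Ici (f 0)) := by
        congr 1
        exact coe_injective (by simpa using hf)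
      _ = n + k - f 0 := Fin.card_Ici _
  have hf0 : f 0 = Fin.natAdd n 0 := Fin.ext (by rw [Fin.val_natAdd, Fin.val_zero]; omega)
  refine DFunLike.coe_injective ((f.strictMono.range_inj (Fin.strictMono_natAdd n)).1 ?_)
  rw [hf, hf0, Fin.range_natAdd_eq_Ici]

lemma IsMinimalFor.isReduced (hρ : IsCayleyPerm ρ) (hdiag : ∀ j, ρ j ≤ ρ 0 + j)
    {σ : Fin (n + k) → ℕ} (hσ : IsMinimalFor ρ σ) : IsReduced ρ σ := by
  obtain ⟨f, hf⟩ := hσ.1.2.2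
  replace hf : OrderIsomorphic ρ (σ ∘ f) := hf
  have hrange : ∀ x : Fin (n + k), σ (f 0) ≤ x → x ∈ Set.range f := fun x hx =>
    hσ.mem_range_of_le hρ hdiag hf hx
  have hdiagonal : σ (f 0) = f 0 := by
    refine (hσ.1.1 (f 0)).antisymm ?_
    obtain ⟨i, hi⟩ := hrange ⟨σ (f 0), (hσ.1.1 (f 0)).trans_lt (f 0).2⟩ le_rfl
    have hle : f 0 ≤ f i := f.monotone (Fin.zero_le i)
    rwa [hi] at hle
  obtain rfl : f = Fin.natAddOrderEmb n := eq_natAddOrderEmb_of_range_eq_Ici <| by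
    refine Set.Subset.antisymm ?_ fun x hx => hrange x (hdiagonal.trans_le hx)
    rintro _ ⟨i, rfl⟩
    exact f.monotone (Fin.zero_le i)
  exact ⟨hσ.1.1, hσ.1.2.1, hf, by simpa using hdiagonal, fun i =>
    hσ.exists_ne_apply_eq hf fun ⟨j, hj⟩ =>
      (castAdd_lt_natAdd i j).ne' hj⟩

lemma IsReduced.repeats_suffix {σ : Fin (n + k) → ℕ} (h : IsReduced ρ σ) :
    repeats σ (Ici (Fin.natAdd n 0)) = repeats ρ univ := by
  have hsuffix : Ici (Fin.natAdd n 0) = univ.map (Fin.natAddOrderEmb (m := k) n).toEmbedding :=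
    coe_injective <| by
      rw [coe_map, coe_univ, Set.image_univ, coe_Ici]
      exact (Fin.range_natAdd_eq_Ici n k).symm
  rw [hsuffix, OrderIsomorphic.repeats_eq (f := (Fin.natAddOrderEmb n).toEmbedding) h.occ]

lemma IsReduced.repeats_univ (hρ : IsCayleyPerm ρ) {σ : Fin (n + k) → ℕ} (h : IsReduced ρ σ) :
    repeats σ univ = repeats ρ univ + ρ 0 := by
  set B := univ.image (σ ∘ Fin.natAdd n) with hB
  have himage : univ.image σ = B ∪ range n := by
    ext v
    simp only [hB, mem_image, mem_univ, true_and, mem_union, mem_range, Function.comp_apply]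
    constructor
    · rintro ⟨x, rfl⟩
      induction x using Fin.addCases with
      | left i => exact .inr ((h.inv (Fin.castAdd k i)).trans_lt i.2)
      | right j => exact .inl ⟨j, rfl⟩
    · rintro (⟨j, hj⟩ | hv)
      · exact ⟨_, hj⟩
      · exact isCayleyPerm_iff.1 h.cayley (Fin.natAdd n 0) v (hv.le.trans h.first.ge)
  have hinter : #(B ∩ range n) = ρ 0 := by
    rw [← hρ.card_values_lt h.occ 0]
    congr 1
    ext v
    simp [hB, h.first]
  have hunion := card_union_add_card_inter B (range n)
  have hσ := repeats_add_card_image σ univ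
  have hρ' := repeats_add_card_image ρ univ
  rw [h.occ.card_image, ← hB] at hρ'
  rw [hinter, ← himage, card_range] at hunion
  rw [card_fin] at hσ hρ'
  omega

lemma orderEmb_apply_eq_of_forall_le_mem_range {l N : ℕ} {f : Fin l ↪o Fin N} {i : Fin l}
    {x : Fin N} (hx : ∀ y ≤ x, y ∈ Set.range f) (hi : (i : ℕ) = x) : f i = x := by
  obtain ⟨j, rfl⟩ := hx x le_rfl
  have hIio : {y ∈ univ.map f.toEmbedding | y < f j} = Iio (f j) := by
    ext y
    simpa using fun hy : y < f j => hx y hy.le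
  have hj := card_filter_lt_orderEmb f j
  rw [hIio, Fin.card_Iio, ← hi] at hj
  rw [Fin.ext hj]

lemma IsReduced.eq_of_notMem_range (hρ : IsCayleyPerm ρ) {τ : Fin (n' + k) → ℕ}
    {σ : Fin (n + k) → ℕ} (hτ : IsReduced ρ τ) (hσ : IsReduced ρ σ)
    {f : Fin (n' + k) ↪o Fin (n + k)} (hf : OrderIsomorphic τ (σ ∘ f)) {x y : Fin (n + k)}
    (hx : x ∉ Set.range f) (hyx : σ y = σ x) : y = x := by
  have hrepeats : repeats σ (univ.map f.toEmbedding) = repeats σ univ := by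
    rw [← OrderIsomorphic.repeats_eq (f := f.toEmbedding) hf, hτ.repeats_univ hρ,
      hσ.repeats_univ hρ]
  exact (repeats_eq_iff (subset_univ _)).1 hrepeats x (mem_univ x) (by simpa using hx) y
    (mem_univ y) hyx

lemma IsReduced.castAdd_mem_range (hρ : IsCayleyPerm ρ) {τ : Fin (n' + k) → ℕ}
    {σ : Fin (n + k) → ℕ} (hτ : IsReduced ρ τ) (hσ : IsReduced ρ σ)
    {f : Fin (n' + k) ↪o Fin (n + k)} (hf : OrderIsomorphic τ (σ ∘ f)) (i : Fin n) :
    Fin.castAdd k i ∈ Set.range f := by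
  by_contra hi
  obtain ⟨y, hne, hy⟩ := hσ.twin i
  exact hne (hτ.eq_of_notMem_range hρ hσ hf hi hy)

lemma IsReduced.length_eq (hρ : IsCayleyPerm ρ) {τ : Fin (n' + k) → ℕ} {σ : Fin (n + k) → ℕ}
    (hτ : IsReduced ρ τ) (hσ : IsReduced ρ σ) (h : Contains τ σ) : n' = n := by
  by_contra hne
  have hlt : n' < n := by have := h.length_le; omega
  obtain ⟨f, hf⟩ := h
  replace hf : OrderIsomorphic τ (σ ∘ f) := hf
  set p : Fin (n + k) := Fin.castAdd k ⟨n', hlt⟩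
  have hpn : p < Fin.natAdd n 0 := castAdd_lt_natAdd _ _
  have hp : f (Fin.natAdd n' 0) = p := orderEmb_apply_eq_of_forall_le_mem_range
    (fun y hy => hτ.castAdd_mem_range hρ hσ hf ⟨y, (Fin.le_def.1 hy).trans_lt hlt⟩) rfl
  have hσp : σ p = n' := by
    refine (hσ.inv p).antisymm ?_
    calc n' = τ (Fin.natAdd n' 0) := hτ.first.symm
      _ ≤ σ p := hp ▸ hτ.cayley.le_of_orderIsomorphic hf _
  have hsub : (Ici (Fin.natAdd n' 0)).map f.toEmbedding ⊆ Ici p := fun y hy => by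
    obtain ⟨i, hi, rfl⟩ := mem_map.1 hy
    exact mem_Ici.2 (hp ▸ f.monotone (mem_Ici.1 hi))
  -- Beyond `p`, the copy of the suffix of `τ` misses only entries whose value is not repeated.
  have hrepeats : repeats σ (Ici (Fin.natAdd n 0)) = repeats σ (Ici p) := by
    rw [hσ.repeats_suffix, ← hτ.repeats_suffix,
      OrderIsomorphic.repeats_eq (f := f.toEmbedding) hf,
      (repeats_eq_iff hsub).2]
    refine fun x hx hxE y _ hyx => hτ.eq_of_notMem_range hρ hσ hf ?_ hyx
    rintro ⟨i, rfl⟩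
    rw [mem_Ici, ← hp, f.le_iff_le, ← mem_Ici] at hx
    exact hxE (mem_map_of_mem _ hx)
  obtain ⟨y, hyp, hy⟩ := hσ.twin ⟨n', hlt⟩
  exact hyp ((repeats_eq_iff (Ici_subset_Ici.2 hpn.le)).1 hrepeats p (mem_Ici.2 le_rfl)
    (by simpa using hpn) y (mem_Ici.2 (hσp.ge.trans (hy ▸ hσ.inv y))) hy)

lemma isMinimalFor_iff_isReduced (hρ : IsCayleyPerm ρ) (hdiag : ∀ j, ρ j ≤ ρ 0 + j)
    {σ : Fin (n + k) → ℕ} : IsMinimalFor ρ σ ↔ IsReduced ρ σ := by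
  refine ⟨fun hσ => hσ.isReduced hρ hdiag, fun hσ => ?_⟩
  refine ⟨⟨hσ.inv, hσ.cayley, Fin.natAddOrderEmb n, hσ.occ⟩, fun p τ hτ hτσ => ?_⟩
  obtain ⟨q, υ, hυ, hυτ⟩ := hτ.exists_isMinimalFor
  obtain ⟨n', rfl⟩ := Nat.exists_eq_add_of_le' hυ.1.2.2.length_le
  obtain rfl := (hυ.isReduced hρ hdiag).length_eq hρ hσ (hυτ.trans hτσ)
  exact hτσ.symm_of_length_le hυτ.length_le

end Reduced

section Colouring

variable {k n : ℕ} {ρ : Fin k → ℕ} {x : (Fin n → ℕ) × (Fin n → Colour)}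

/-- The values that a colouring of `0, …, n - 1` leaves to the last `k` entries of a reduced
sequence: the blue ones, and all those from `n` on. -/
def IsAvailable (c : Fin n → Colour) (v : ℕ) : Prop :=
  ∀ h : v < n, c ⟨v, h⟩ = Colour.blue

lemma isAvailable_of_le (c : Fin n → Colour) {v : ℕ} (hv : n ≤ v) : IsAvailable c v :=
  fun h => absurd h hv.not_gt

lemma isAvailable_val_iff {c : Fin n → Colour} {v : Fin n} :
    IsAvailable c v ↔ c v = Colour.blue :=
  ⟨fun h => h v.2, fun h _ => h⟩

lemma infinite_isAvailable (c : Fin n → Colour) : {v | IsAvailable c v}.Infinite :=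
  (Set.Ici_infinite n).mono fun _ => isAvailable_of_le c

open Classical in
lemma ncard_blue (c : Fin n → Colour) :
    {v : Fin n | c v = Colour.blue}.ncard = Nat.count (IsAvailable c) n := by
  have hmap : {v ∈ range n | IsAvailable c v} =
      ({v : Fin n | c v = Colour.blue} : Finset (Fin n)).map Fin.valEmbedding := by
    ext v
    simp only [mem_filter, mem_map, mem_univ, true_and, mem_range, Fin.valEmbedding_apply]
    exact ⟨fun ⟨h, hc⟩ => ⟨⟨v, h⟩, hc h, rfl⟩,
      fun ⟨w, hw, hv⟩ => hv ▸ ⟨w.2, isAvailable_val_iff.2 hw⟩⟩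
  rw [Nat.count_eq_card_filter_range, hmap, card_map, ← Set.ncard_coe_finset, coe_filter]
  simp

lemma nth_isAvailable_add {c : Fin n → Colour} {m : ℕ}
    (hm : {v : Fin n | c v = Colour.blue}.ncard = m) (t : ℕ) :
    Nat.nth (IsAvailable c) (m + t) = n + t := by
  classical
  have hcount : Nat.count (IsAvailable c) (n + t) = m + t := by
    rw [Nat.count_add, ← ncard_blue, hm,
      Nat.count_of_forall fun _ _ => isAvailable_of_le c (Nat.le_add_right _ _)]
  rw [← hcount, Nat.nth_count (isAvailable_of_le c (Nat.le_add_right n t))]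

lemma colour_eq_red_iff {c : Colour} : c = Colour.red ↔ c ≠ Colour.blue := by
  cases c <;> simp

lemma ncard_red (c : Fin n → Colour) :
    {v : Fin n | c v = Colour.red}.ncard = n - {v : Fin n | c v = Colour.blue}.ncard := by
  have hcompl : {v : Fin n | c v = Colour.red} = {v : Fin n | c v = Colour.blue}ᶜ :=
    Set.ext fun v => colour_eq_red_iff
  rw [hcompl, Set.ncard_compl, Nat.card_fin]

/-- The coloured inversion sequence of a reduced sequence: its first `n` entries, with the values
that the last `k` entries use coloured blue. -/
noncomputable def toColoured (σ : Fin (n + k) → ℕ) : (Fin n → ℕ) × (Fin n → Colour) :=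
  open Classical in
  (fun i => σ (Fin.castAdd k i),
    fun v => if ∃ j, σ (Fin.natAdd n j) = v then Colour.blue else Colour.red)

lemma toColoured_blue_iff {σ : Fin (n + k) → ℕ} {v : Fin n} :
    (toColoured σ).2 v = Colour.blue ↔ ∃ j, σ (Fin.natAdd n j) = v := by
  simp [toColoured]

/-- The inverse of `toColoured`: the last `k` entries are the occurrence of `ρ` in which the `i`-th
smallest value is the `i`-th available one. -/
noncomputable def fromColoured (ρ : Fin k → ℕ) (x : (Fin n → ℕ) × (Fin n → Colour)) :
    Fin (n + k) → ℕ :=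
  Fin.append x.1 fun j => Nat.nth (IsAvailable x.2) (ρ j)

lemma fromColoured_castAdd (ρ : Fin k → ℕ) (x : (Fin n → ℕ) × (Fin n → Colour)) (i : Fin n) :
    fromColoured ρ x (Fin.castAdd k i) = x.1 i :=
  Fin.append_left _ _ i

lemma fromColoured_natAdd (ρ : Fin k → ℕ) (x : (Fin n → ℕ) × (Fin n → Colour)) (j : Fin k) :
    fromColoured ρ x (Fin.natAdd n j) = Nat.nth (IsAvailable x.2) (ρ j) :=
  Fin.append_right _ _ j

lemma orderIsomorphic_fromColoured (ρ : Fin k → ℕ) (x : (Fin n → ℕ) × (Fin n → Colour)) :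
    OrderIsomorphic ρ (fromColoured ρ x ∘ Fin.natAdd n) := fun i j => by
  simp only [Function.comp_apply, fromColoured_natAdd, Nat.nth_lt_nth (infinite_isAvailable x.2)]

lemma exists_fromColoured_natAdd_eq (hρ : IsCayleyPerm ρ) {v : ℕ} (hv : IsAvailable x.2 v)
    {j : Fin k} (hvj : v ≤ fromColoured ρ x (Fin.natAdd n j)) :
    ∃ i, fromColoured ρ x (Fin.natAdd n i) = v := by
  classical
  have hcount := Nat.count_monotone (IsAvailable x.2) hvj
  rw [fromColoured_natAdd, Nat.count_nth_of_infinite (infinite_isAvailable x.2)] at hcount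
  obtain ⟨i, hi⟩ := isCayleyPerm_iff.1 hρ j _ hcount
  exact ⟨i, by rw [fromColoured_natAdd, hi, Nat.nth_count hv]⟩

variable [NeZero k]

lemma IsReduced.isAvailable_iff {σ : Fin (n + k) → ℕ} (h : IsReduced ρ σ) {j : Fin k} {v : ℕ}
    (hv : v ≤ σ (Fin.natAdd n j)) :
    IsAvailable (toColoured σ).2 v ↔ ∃ i, σ (Fin.natAdd n i) = v := by
  rcases lt_or_ge v n with hvn | hnv
  · exact (isAvailable_val_iff (v := ⟨v, hvn⟩)).trans toColoured_blue_iff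
  · refine iff_of_true (isAvailable_of_le _ hnv) ?_
    obtain ⟨x, rfl⟩ := isCayleyPerm_iff.1 h.cayley _ v hv
    induction x using Fin.addCases with
    | left i => exact absurd (h.inv (Fin.castAdd k i)) (i.2.trans_le hnv).not_ge
    | right i => exact ⟨i, rfl⟩

open Classical in
lemma IsReduced.count_isAvailable (hρ : IsCayleyPerm ρ) {σ : Fin (n + k) → ℕ}
    (h : IsReduced ρ σ) (j : Fin k) :
    Nat.count (IsAvailable (toColoured σ).2) (σ (Fin.natAdd n j)) = ρ j := by
  rw [← hρ.card_values_lt h.occ j, Nat.count_eq_card_filter_range]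
  congr 1
  ext v
  simp only [mem_filter, mem_range, mem_image, mem_univ, true_and, Function.comp_apply]
  rw [and_comm]
  exact and_congr_left fun hv => h.isAvailable_iff hv.le

lemma IsReduced.toColoured_mem (hρ : IsCayleyPerm ρ) {σ : Fin (n + k) → ℕ}
    (h : IsReduced ρ σ) : toColoured σ ∈ colouredSeqs n (ρ 0) := by
  classical
  have hblue : {v : Fin n | (toColoured σ).2 v = Colour.blue}.ncard = ρ 0 := by
    rw [ncard_blue, ← h.count_isAvailable hρ 0, h.first]
  refine ⟨fun i => h.inv (Fin.castAdd k i), hblue, by rw [ncard_red, hblue], fun v hv => ?_⟩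
  have hprefix : ∀ x, σ x = v → ∃ i, Fin.castAdd k i = x := fun x hx => by
    rw [colour_eq_red_iff, Ne, toColoured_blue_iff] at hv
    induction x using Fin.addCases with
    | left i => exact ⟨i, rfl⟩
    | right j => exact absurd ⟨j, hx⟩ hv
  obtain ⟨x, hx⟩ := isCayleyPerm_iff.1 h.cayley (Fin.natAdd n 0) v (v.2.le.trans h.first.ge)
  obtain ⟨i, rfl⟩ := hprefix x hx
  obtain ⟨y, hyi, hy⟩ := h.twin i
  obtain ⟨i', rfl⟩ := hprefix y (hy.trans hx)
  exact (Set.one_lt_ncard_iff (Set.toFinite _)).2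
    ⟨i', i, hy.trans hx, hx, fun hi => hyi (by rw [hi])⟩

lemma IsReduced.fromColoured_toColoured (hρ : IsCayleyPerm ρ) {σ : Fin (n + k) → ℕ}
    (h : IsReduced ρ σ) : fromColoured ρ (toColoured σ) = σ := by
  classical
  ext x
  induction x using Fin.addCases with
  | left i => exact Fin.append_left _ _ i
  | right j =>
    rw [fromColoured, Fin.append_right, ← h.count_isAvailable hρ j]
    exact Nat.nth_count ((h.isAvailable_iff le_rfl).2 ⟨j, rfl⟩)

lemma fromColoured_natAdd_zero (hx : x ∈ colouredSeqs n (ρ 0)) :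
    fromColoured ρ x (Fin.natAdd n 0) = n := by
  simpa [fromColoured_natAdd] using nth_isAvailable_add hx.2.1 0

lemma isInversionSeq_fromColoured (hdiag : ∀ j, ρ j ≤ ρ 0 + j)
    (hx : x ∈ colouredSeqs n (ρ 0)) : IsInversionSeq (fromColoured ρ x) := by
  intro y
  induction y using Fin.addCases with
  | left i => exact (fromColoured_castAdd ρ x i).trans_le (hx.1 i)
  | right j =>
    rw [fromColoured_natAdd, Fin.val_natAdd, ← nth_isAvailable_add hx.2.1]
    exact Nat.nth_monotone (infinite_isAvailable x.2) (hdiag j)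

lemma exists_fromColoured_natAdd_eq_iff (hρ : IsCayleyPerm ρ) (hx : x ∈ colouredSeqs n (ρ 0))
    {v : Fin n} : (∃ j, fromColoured ρ x (Fin.natAdd n j) = v) ↔ x.2 v = Colour.blue := by
  rw [← isAvailable_val_iff]
  refine ⟨fun ⟨j, hj⟩ => ?_, fun hv => ?_⟩
  · rw [← hj, fromColoured_natAdd]
    exact Nat.nth_mem_of_infinite (infinite_isAvailable x.2) _
  · exact exists_fromColoured_natAdd_eq hρ hv (v.2.le.trans (fromColoured_natAdd_zero hx).ge)

lemma exists_ne_fromColoured_eq (hρ : IsCayleyPerm ρ) (hx : x ∈ colouredSeqs n (ρ 0))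
    (v : Fin n) (i : Fin n) : ∃ y, y ≠ Fin.castAdd k i ∧ fromColoured ρ x y = v := by
  cases hv : x.2 v with
  | blue =>
    obtain ⟨j, hj⟩ := (exists_fromColoured_natAdd_eq_iff hρ hx).2 hv
    exact ⟨_, (castAdd_lt_natAdd i j).ne', hj⟩
  | red =>
    obtain ⟨i', hi', hne⟩ := Set.exists_ne_of_one_lt_ncard (hx.2.2.2 v hv) i
    exact ⟨Fin.castAdd k i', fun h => hne (Fin.castAdd_injective n k h),
      (fromColoured_castAdd ρ x i').trans hi'⟩

lemma isCayleyPerm_fromColoured (hρ : IsCayleyPerm ρ) (hx : x ∈ colouredSeqs n (ρ 0)) :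
    IsCayleyPerm (fromColoured ρ x) := by
  refine isCayleyPerm_iff.2 fun y v hv => ?_
  rcases lt_or_ge v n with hvn | hnv
  · obtain ⟨z, -, hz⟩ := exists_ne_fromColoured_eq hρ hx ⟨v, hvn⟩ ⟨v, hvn⟩
    exact ⟨z, hz⟩
  · induction y using Fin.addCases with
    | left i =>
      rw [fromColoured_castAdd] at hv
      exact absurd (hv.trans (hx.1 i)) (i.2.trans_le hnv).not_ge
    | right j =>
      obtain ⟨i, hi⟩ := exists_fromColoured_natAdd_eq hρ (isAvailable_of_le x.2 hnv) hv
      exact ⟨_, hi⟩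

lemma isReduced_fromColoured (hρ : IsCayleyPerm ρ) (hdiag : ∀ j, ρ j ≤ ρ 0 + j)
    (hx : x ∈ colouredSeqs n (ρ 0)) : IsReduced ρ (fromColoured ρ x) where
  inv := isInversionSeq_fromColoured hdiag hx
  cayley := isCayleyPerm_fromColoured hρ hx
  occ := orderIsomorphic_fromColoured ρ x
  first := fromColoured_natAdd_zero hx
  twin i := by
    rw [fromColoured_castAdd]
    exact exists_ne_fromColoured_eq hρ hx ⟨x.1 i, (hx.1 i).trans_lt i.2⟩ i

lemma toColoured_fromColoured (hρ : IsCayleyPerm ρ) (hx : x ∈ colouredSeqs n (ρ 0)) :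
    toColoured (fromColoured ρ x) = x := by
  refine Prod.ext (funext (fromColoured_castAdd ρ x)) (funext fun v => ?_)
  have hblue := toColoured_blue_iff.trans (exists_fromColoured_natAdd_eq_iff hρ hx (v := v))
  cases hv : x.2 v with
  | blue => exact hblue.2 hv
  | red =>
    rw [colour_eq_red_iff] at hv ⊢
    exact hblue.not.2 hv

lemma bijOn_toColoured (hρ : IsCayleyPerm ρ) (hdiag : ∀ j, ρ j ≤ ρ 0 + j) (n : ℕ) :
    Set.BijOn toColoured {σ : Fin (n + k) → ℕ | IsReduced ρ σ} (colouredSeqs n (ρ 0)) :=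
  Set.InvOn.bijOn (f' := fromColoured ρ)
    ⟨fun _ hσ => hσ.fromColoured_toColoured hρ, fun _ hx => toColoured_fromColoured hρ hx⟩
    (fun _ hσ => hσ.toColoured_mem hρ) (fun _ hx => isReduced_fromColoured hρ hdiag hx)

end Colouring

lemma le_mdd_add {k : ℕ} [NeZero k] (σ : Fin k → ℕ) (i : Fin k) : (σ i : ℤ) ≤ mdd σ + i :=
  sub_le_iff_le_add.1 (le_sup' (fun i : Fin k => (σ i : ℤ) - ((i : ℕ) : ℤ)) (mem_univ i))

end InvSeq

theorem proposition5p1 (k m : ℕ) [NeZero k] (ρ : Fin k → ℕ) (hρ : InvSeq.IsCayleyPerm ρ)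
    (hfirst : ρ 0 = m) (hmdd : InvSeq.mdd ρ = (m : ℤ)) (n : ℕ) :
    {σ : Fin (n + k) → ℕ | InvSeq.IsMinimalFor ρ σ}.encard =
      (InvSeq.colouredSeqs n m).encard := by
  subst hfirst
  have hdiag : ∀ j, ρ j ≤ ρ 0 + j := fun j => by
    exact_mod_cast hmdd ▸ InvSeq.le_mdd_add ρ j
  have hbij := InvSeq.bijOn_toColoured hρ hdiag n
  simp only [InvSeq.isMinimalFor_iff_isReduced hρ hdiag]
  rw [← hbij.image_eq, hbij.injOn.encard_image]
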